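/- Let $\alpha>0$, $\lambda>0$ and $H=\tfrac12+\alpha$, and let $\{\zeta_j\}_{j\in\mathbb Z}$ be independent, identically distributed real random variables with mean zero and variance one. For $n\ge 1$ put $$C_j^{\lambda/n}=\begin{cases}\frac{1}{\Gamma(\alpha)}\,j^{\alpha-1}e^{-\frac{\lambda}{n}j}, & j\ge 1,\\ 0,& j\le 0,\end{cases}\qquad Y_k^{\lambda/n}=\sum_{j\in\mathbb Z}C_j^{\lambda/n}\,\zeta_{k-j},$$ $$S_n(t)=\sum_{k=1}^{[t]}Y_k^{\lambda/n}+(t-[t])\,Y_{[t]+1}^{\lambda/n},\qquad t\ge 0,$$ where $[t]$ is the integer part of $t$. Let $B(dy)$ be an independently scattered Gaussian random measure on $\mathbb R$ with control measure $\sigma^2\,dy$, where $\sigma=1/\Gamma(\alpha)$, and let $$Z^1_{H,\lambda}(t)=\int_{\mathbb R}\left(\int_0^t (s-y)_+^{H-\frac32}e^{-\lambda(s-y)_+}\,ds\right)B(dy),\qquad t\ge0,$$ be the tempered Hermite process of order one driven by $B$; here $x_+^{\beta}e^{-\lambda x_+}$ means $x^\beta e^{-\lambda x}$ for $x>0$ and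 $0$ for $x\le 0$. Then the finite-dimensional distributions of $n^{-H}S_n(nt)$ converge to those of $Z^1_{H,\lambda}(t)$: for every $p\ge 1$ and all $t_1,\dots,t_p\ge0$, $$\left(n^{-H}S_n(nt_1),\dots,n^{-H}S_n(nt_p)\right)\longrightarrow\left(Z^1_{H,\lambda}(t_1),\dots,Z^1_{H,\lambda}(t_p)\right)$$ in distribution as $n\to\infty$. -/

import Mathlib

open MeasureTheory ProbabilityTheory Filter Topology

namespace TemperedHermite

noncomputable section

/-- `B` is an independently scattered Gaussian random measure on `ℝ` with control measure `m`:
`B A` is defined (as a random variable) for every Borel set `A` with `m A < ∞`, it is centred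
Gaussian with variance `m A`, values on disjoint sets are independent, and `B` is σ-additive in
the sense of mean square convergence. -/
structure IsGaussianRandomMeasure {Ω : Type*} [MeasurableSpace Ω] (P : Measure Ω)
    (m : Measure ℝ) (B : Set ℝ → Ω → ℝ) : Prop where
  hasLaw : ∀ A, MeasurableSet A → m A < ⊤ → HasLaw (B A) (gaussianReal 0 (m A).toNNReal) P
  indep : ∀ A : ℕ → Set ℝ, (∀ i, MeasurableSet (A i)) → (∀ i, m (A i) < ⊤) →
    Pairwise (fun i j => Disjoint (A i) (A j)) → iIndepFun (fun i => B (A i)) P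
  sigmaAdditive : ∀ A : ℕ → Set ℝ, (∀ i, MeasurableSet (A i)) → m (⋃ i, A i) < ⊤ →
    Pairwise (fun i j => Disjoint (A i) (A j)) →
    Tendsto (fun N : ℕ =>
      eLpNorm (fun ω => B (⋃ i, A i) ω - ∑ i ∈ Finset.range N, B (A i) ω) 2 P) atTop (𝓝 0)

/-- The integral `∑ c, c * B {φ = c}` (over the nonzero values `c`) of a simple function `φ`. -/
def simpleIntegral {Ω : Type*} (B : Set ℝ → Ω → ℝ) (φ : SimpleFunc ℝ ℝ) (ω : Ω) : ℝ :=
  ∑ c ∈ φ.range.filter (fun c => c ≠ 0), c * B (φ ⁻¹' {c}) ω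

/-- `X` is (a version of) the stochastic integral `∫ f(y) B(dy)`: the mean square limit of the
integrals of simple functions that converge to `f` in `L²(m)`. -/
def IsStochasticIntegral {Ω : Type*} [MeasurableSpace Ω] (P : Measure Ω) (m : Measure ℝ)
    (B : Set ℝ → Ω → ℝ) (f : ℝ → ℝ) (X : Ω → ℝ) : Prop :=
  MemLp f 2 m ∧ MemLp X 2 P ∧
  ∃ φ : ℕ → SimpleFunc ℝ ℝ, (∀ k, MemLp (φ k) 2 m) ∧
    Tendsto (fun k => eLpNorm (fun y => f y - φ k y) 2 m) atTop (𝓝 0) ∧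
    Tendsto (fun k => eLpNorm (fun ω => X ω - simpleIntegral B (φ k) ω) 2 P) atTop (𝓝 0)

/-- `x ↦ x₊ ^ β * exp (-lam * x₊)`, which vanishes for `x ≤ 0` (also when `β = 0`). -/
def temperedPower (β lam x : ℝ) : ℝ :=
  if 0 < x then x ^ β * Real.exp (-lam * x) else 0

/-- `g_{H,λ,t}(y) = ∫₀ᵗ (s - y)₊ ^ (H - 3/2) * exp (-λ (s - y)₊) ds`. -/
def kernel (H lam t y : ℝ) : ℝ :=
  ∫ s in (0 : ℝ)..t, temperedPower (H - 3 / 2) lam (s - y)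

/-- `Z` is the tempered Hermite process of order one `Z(t) = ∫ g_{H,λ,t}(y) B(dy)`, `t ≥ 0`, driven
by the Gaussian random measure `B` with control measure `σ² dx`. -/
structure IsTHP {Ω : Type*} [MeasurableSpace Ω] (P : Measure Ω) (σ H lam : ℝ)
    (B : Set ℝ → Ω → ℝ) (Z : ℝ → Ω → ℝ) : Prop where
  randomMeasure : IsGaussianRandomMeasure P (ENNReal.ofReal (σ ^ 2) • volume) B
  integral : ∀ t, 0 ≤ t →
    IsStochasticIntegral P (ENNReal.ofReal (σ ^ 2) • volume) B (kernel H lam t) (Z t)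

/-- `C_j = j ^ (α - 1) * exp (-κ j) / Γ(α)` for `j ≥ 1`, and `C_j = 0` for `j ≤ 0`. -/
def coeff (α κ : ℝ) (j : ℤ) : ℝ :=
  if 1 ≤ j then 1 / Real.Gamma α * (j : ℝ) ^ (α - 1) * Real.exp (-κ * j) else 0

/-- The moving average `Y_k = ∑_{j ∈ ℤ} C_j ζ_{k - j}`. -/
def movingAverage {Ω : Type*} (α κ : ℝ) (ζ : ℤ → Ω → ℝ) (k : ℤ) (ω : Ω) : ℝ :=
  ∑' j : ℤ, coeff α κ j * ζ (k - j) ω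

/-- The linearly interpolated partial sum
`S(t) = ∑_{k=1}^{[t]} Y_k + (t - [t]) Y_{[t]+1}`, for `t ≥ 0`. -/
def partialSum {Ω : Type*} (α κ : ℝ) (ζ : ℤ → Ω → ℝ) (t : ℝ) (ω : Ω) : ℝ :=
  ∑ k ∈ Finset.Icc 1 ⌊t⌋₊, movingAverage α κ ζ (k : ℤ) ω
    + (t - (⌊t⌋₊ : ℝ)) * movingAverage α κ ζ ((⌊t⌋₊ : ℤ) + 1) ω

end

end TemperedHermite

/-!
The weight of each innovation in a normalized partial sum is `n ^ (-1/2) / Γ(α)` times the kernel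
of the limit process, with both of its variables rounded down to the grid of mesh `1 / n`. These
weights tend to zero uniformly, while their sum of squares is `Γ(α)⁻²` times the integral of the
squared rounded kernel, which converges by domination. Uniformly small weights with convergent sum
of squares give a Gaussian limit (compare the characteristic function, factor by factor, with the
Gaussian one). Since linear combinations of stochastic integrals are Gaussian with variance given by
the Itô isometry, the Cramér–Wold device reduces the theorem to this.
-/

namespace TemperedHermite

section WeakConvergence

variable {Ω Ω' ι : Type*} [MeasurableSpace Ω] [MeasurableSpace Ω'] {P : Measure Ω}
  {P' : Measure Ω'}

lemma charFun_map_toLp [Fintype ι] {X : Ω → ι → ℝ} (hX : AEMeasurable X P)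
    (u : EuclideanSpace ℝ ι) :
    charFun (P.map fun ω => WithLp.toLp 2 (X ω)) u =
      charFun (P.map fun ω => ∑ r, u r * X ω r) 1 := by
  have hX_toLp : AEMeasurable (fun ω => WithLp.toLp 2 (X ω)) P := by fun_prop
  have hX_sum : AEMeasurable (fun ω => ∑ r, u r * X ω r) P := by fun_prop
  rw [charFun_apply, charFun_apply_real, integral_map hX_toLp (by fun_prop),
    integral_map hX_sum (by fun_prop)]
  congr 1 with ω
  simp [PiLp.inner_apply, mul_comm]

lemma tendsto_charFun_of_tendstoInDistribution [IsProbabilityMeasure P] [IsProbabilityMeasure P']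
    {κ : Type*} {l : Filter κ} {X : κ → Ω → ℝ} {Z : Ω' → ℝ}
    (h : TendstoInDistribution X l Z (fun _ => P) P') (x : ℝ) :
    Tendsto (fun i => charFun (P.map (X i)) x) l (𝓝 (charFun (P'.map Z) x)) := by
  have h_integral := (ProbabilityMeasure.tendsto_iff_forall_integral_rclike_tendsto ℂ).1 h.tendsto
    (BoundedContinuousFunction.innerProbChar x)
  simp only [charFun_eq_integral_innerProbChar]
  exact h_integral

/-- The **Cramér–Wold device**. -/
theorem tendstoInDistribution_pi_of_forall_sum [IsProbabilityMeasure P] [IsProbabilityMeasure P']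
    [Fintype ι] {X : ℕ → Ω → ι → ℝ} {Z : Ω' → ι → ℝ}
    (hX : ∀ n, AEMeasurable (X n) P) (hZ : AEMeasurable Z P')
    (h : ∀ u : ι → ℝ, TendstoInDistribution (fun n ω => ∑ r, u r * X n ω r) atTop
      (fun ω => ∑ r, u r * Z ω r) (fun _ => P) P') :
    TendstoInDistribution X atTop Z (fun _ => P) P' := by
  have h_toLp : TendstoInDistribution (fun n ω => WithLp.toLp 2 (X n ω)) atTop
      (fun ω => WithLp.toLp 2 (Z ω)) (fun _ => P) P' :=
    { forall_aemeasurable := fun n => by have := hX n; fun_prop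
      aemeasurable_limit := by fun_prop
      tendsto := by
        refine ProbabilityMeasure.tendsto_iff_tendsto_charFun.2 fun u => ?_
        simp only [ProbabilityMeasure.coe_mk, charFun_map_toLp (hX _), charFun_map_toLp hZ]
        exact tendsto_charFun_of_tendstoInDistribution (h u) 1 }
  exact h_toLp.continuous_comp (g := WithLp.ofLp) (by fun_prop)

lemma norm_prod_sub_prod_le_sum {R : Type*} [NormedCommRing R] [NormOneClass R] (s : Finset ι)
    {a b : ι → R} (ha : ∀ i, ‖a i‖ ≤ 1) (hb : ∀ i, ‖b i‖ ≤ 1) :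
    ‖∏ i ∈ s, a i - ∏ i ∈ s, b i‖ ≤ ∑ i ∈ s, ‖a i - b i‖ := by
  classical
  induction s using Finset.induction_on with
  | empty => simp
  | insert i s hi ih =>
    rw [Finset.prod_insert hi, Finset.prod_insert hi, Finset.sum_insert hi]
    have h_prod : ‖∏ j ∈ s, a j‖ ≤ 1 :=
      (s.norm_prod_le a).trans (Finset.prod_le_one (fun _ _ => norm_nonneg _) fun j _ => ha j)
    calc ‖a i * ∏ j ∈ s, a j - b i * ∏ j ∈ s, b j‖
        = ‖(a i - b i) * ∏ j ∈ s, a j + b i * (∏ j ∈ s, a j - ∏ j ∈ s, b j)‖ := by ring_nf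
      _ ≤ ‖a i - b i‖ * ‖∏ j ∈ s, a j‖ + ‖b i‖ * ‖∏ j ∈ s, a j - ∏ j ∈ s, b j‖ :=
        (norm_add_le _ _).trans (add_le_add (norm_mul_le _ _) (norm_mul_le _ _))
      _ ≤ ‖a i - b i‖ * 1 + 1 * ∑ j ∈ s, ‖a j - b j‖ := by
        gcongr
        exact hb i
      _ = ‖a i - b i‖ + ∑ j ∈ s, ‖a j - b j‖ := by ring

lemma charFun_isLittleO_sq {μ : Measure ℝ} [IsProbabilityMeasure μ] (h0 : ∫ x, x ∂μ = 0)
    (h1 : ∫ x, x ^ 2 ∂μ = 1) :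
    (fun x => charFun μ x - (1 - x ^ 2 / 2)) =o[𝓝 0] fun x => x ^ 2 := by
  simpa using taylor_charFun_two (X := id) aemeasurable_id h0 h1

lemma charFun_sub_charFun_gaussianReal_isLittleO {μ : Measure ℝ} [IsProbabilityMeasure μ]
    (h0 : ∫ x, x ∂μ = 0) (h1 : ∫ x, x ^ 2 ∂μ = 1) :
    (fun x => charFun μ x - charFun (gaussianReal 0 1) x) =o[𝓝 0] fun x => x ^ 2 := by
  have h_sq : ∫ x, x ^ 2 ∂gaussianReal 0 1 = 1 := by
    rw [← variance_of_integral_eq_zero aemeasurable_id' integral_id_gaussianReal,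
      variance_fun_id_gaussianReal, NNReal.coe_one]
  simpa only [sub_sub_sub_cancel_right] using
    (charFun_isLittleO_sq h0 h1).sub (charFun_isLittleO_sq integral_id_gaussianReal h_sq)

variable [IsProbabilityMeasure P] {ζ : ι → Ω → ℝ} {μ : Measure ℝ}

lemma norm_charFun_finsetSum_mul_sub_le (hindep : iIndepFun ζ P) (hμ : ∀ i, HasLaw (ζ i) μ P)
    {ε δ t : ℝ}
    (hδ : ∀ x : ℝ, |x| ≤ δ → ‖charFun μ x - charFun (gaussianReal 0 1) x‖ ≤ ε * x ^ 2)
    {a : ι → ℝ} (ha : ∀ i, |a i * t| ≤ δ) (s : Finset ι) :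
    ‖charFun (P.map fun ω => ∑ i ∈ s, a i * ζ i ω) t -
        Complex.exp (-((∑ i ∈ s, a i ^ 2 : ℝ) * (t : ℂ) ^ 2 / 2))‖ ≤
      ε * ((∑ i ∈ s, a i ^ 2) * t ^ 2) := by
  have hm (i) : AEMeasurable (ζ i) P := (hμ i).aemeasurable
  have hindep_mul : iIndepFun (fun i ω => a i * ζ i ω) P :=
    hindep.comp (fun i x => a i * x) (fun i => by fun_prop)
  have h_exp : Complex.exp (-((∑ i ∈ s, a i ^ 2 : ℝ) * (t : ℂ) ^ 2 / 2)) =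
      ∏ i ∈ s, charFun (gaussianReal 0 1) (a i * t) := by
    simp only [charFun_gaussianReal, ← Complex.exp_sum]
    congr 1
    push_cast
    rw [Finset.sum_mul, Finset.sum_div, ← Finset.sum_neg_distrib]
    exact Finset.sum_congr rfl fun i _ => by ring
  have h_prod : charFun (P.map fun ω => ∑ i ∈ s, a i * ζ i ω) t =
      ∏ i ∈ s, charFun (P.map (ζ i)) (a i * t) := by
    rw [(hindep_mul.restrict s).charFun_map_fun_finsetSum_eq_prod
      (fun i _ => (hm i).const_mul _), Finset.prod_apply]
    simp_rw [charFun_map_mul_comp (hm _)]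
  have hP (i) : IsProbabilityMeasure (P.map (ζ i)) := Measure.isProbabilityMeasure_map (hm i)
  rw [h_prod, h_exp, Finset.sum_mul, Finset.mul_sum]
  refine (norm_prod_sub_prod_le_sum s (fun i => norm_charFun_le_one _)
    fun i => norm_charFun_le_one _).trans (Finset.sum_le_sum fun i _ => ?_)
  rw [(hμ i).map_eq, ← mul_pow]
  exact hδ _ (ha i)

lemma norm_charFun_sub_le_of_hasSum_mul [Countable ι] (hindep : iIndepFun ζ P)
    (hμ : ∀ i, HasLaw (ζ i) μ P) {ε δ t : ℝ}
    (hδ : ∀ x : ℝ, |x| ≤ δ → ‖charFun μ x - charFun (gaussianReal 0 1) x‖ ≤ ε * x ^ 2)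
    {a : ι → ℝ} (ha : ∀ i, |a i * t| ≤ δ) (hsum : Summable fun i => a i ^ 2)
    {W : Ω → ℝ} (hW : AEMeasurable W P) (h : ∀ᵐ ω ∂P, HasSum (fun i => a i * ζ i ω) (W ω)) :
    ‖charFun (P.map W) t - Complex.exp (-((∑' i, a i ^ 2 : ℝ) * (t : ℂ) ^ 2 / 2))‖ ≤
      ε * ((∑' i, a i ^ 2) * t ^ 2) := by
  have hms (s : Finset ι) : AEMeasurable (fun ω => ∑ i ∈ s, a i * ζ i ω) P :=
    Finset.aemeasurable_fun_sum _ fun i _ => (hμ i).aemeasurable.const_mul _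
  have h_charFun := tendsto_charFun_of_tendstoInDistribution
    (tendstoInDistribution_of_ae_tendsto hms hW h) t
  have h_exp : Tendsto
      (fun s : Finset ι => Complex.exp (-((∑ i ∈ s, a i ^ 2 : ℝ) * (t : ℂ) ^ 2 / 2))) atTop
      (𝓝 (Complex.exp (-((∑' i, a i ^ 2 : ℝ) * (t : ℂ) ^ 2 / 2)))) := by
    have : Continuous fun v : ℝ => Complex.exp (-(v * (t : ℂ) ^ 2 / 2)) := by fun_prop
    exact (this.tendsto _).comp hsum.hasSum
  exact le_of_tendsto_of_tendsto (h_charFun.sub h_exp).norm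
    ((hsum.hasSum.mul_const _).const_mul ε)
    (Eventually.of_forall (norm_charFun_finsetSum_mul_sub_le hindep hμ hδ ha))

/-- **Central limit theorem** for weighted sums, under uniform asymptotic negligibility of the
weights. -/
theorem tendstoInDistribution_of_hasSum_mul [Countable ι] [Nonempty ι] [IsProbabilityMeasure P']
    (hindep : iIndepFun ζ P) (hμ : ∀ i, HasLaw (ζ i) μ P) (h0 : ∫ x, x ∂μ = 0)
    (h1 : ∫ x, x ^ 2 ∂μ = 1) {a : ℕ → ι → ℝ} {c : ℕ → ℝ} (hc : Tendsto c atTop (𝓝 0))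
    (hac : ∀ᶠ n in atTop, ∀ i, |a n i| ≤ c n) (hsum : ∀ᶠ n in atTop, Summable fun i => a n i ^ 2)
    {V : NNReal} (hV : Tendsto (fun n => ∑' i, a n i ^ 2) atTop (𝓝 V))
    {W : ℕ → Ω → ℝ} (hW : ∀ n, AEMeasurable (W n) P)
    (haW : ∀ᶠ n in atTop, ∀ᵐ ω ∂P, HasSum (fun i => a n i * ζ i ω) (W n ω))
    {Z : Ω' → ℝ} (hZ : HasLaw Z (gaussianReal 0 V) P') :
    TendstoInDistribution W atTop Z (fun _ => P) P' := by
  obtain ⟨i₀⟩ := ‹Nonempty ι›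
  have : IsProbabilityMeasure μ := (hμ i₀).isProbabilityMeasure_iff.1 inferInstance
  refine ⟨hW, hZ.aemeasurable, ProbabilityMeasure.tendsto_iff_tendsto_charFun.2 fun t => ?_⟩
  simp only [ProbabilityMeasure.coe_mk, hZ.map_eq, charFun_gaussianReal]
  have h_exp : Tendsto (fun n => Complex.exp (-((∑' i, a n i ^ 2 : ℝ) * (t : ℂ) ^ 2 / 2))) atTop
      (𝓝 (Complex.exp (t * (0 : ℝ) * Complex.I - V * t ^ 2 / 2))) := by
    have : Continuous fun v : ℝ => Complex.exp (-(v * (t : ℂ) ^ 2 / 2)) := by fun_prop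
    simpa [Function.comp_def] using (this.tendsto V).comp hV
  suffices h_diff : Tendsto (fun n => charFun (P.map (W n)) t -
      Complex.exp (-((∑' i, a n i ^ 2 : ℝ) * (t : ℂ) ^ 2 / 2))) atTop (𝓝 0) by
    simpa using h_diff.add h_exp
  rw [Metric.tendsto_nhds]
  intro η hη
  have hVt : 0 < V * t ^ 2 + 1 := by positivity
  obtain ⟨δ, hδ, hμδ⟩ := Metric.eventually_nhds_iff_ball.1
    ((charFun_sub_charFun_gaussianReal_isLittleO h0 h1).bound (div_pos hη hVt))
  filter_upwards [hac, hsum, haW, (hV.mul_const (t ^ 2)).eventually_lt_const (lt_add_one _),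
    (hc.mul_const |t|).eventually_lt_const (show 0 * |t| < δ / 2 by simpa using hδ)]
    with n hac hsum haW hV hc
  rw [dist_zero_right]
  calc ‖_‖ ≤ η / (V * t ^ 2 + 1) * ((∑' i, a n i ^ 2) * t ^ 2) := by
        refine norm_charFun_sub_le_of_hasSum_mul (δ := δ / 2) hindep hμ (fun x hx => ?_)
          (fun i => ?_) hsum (hW n) haW
        · simpa using hμδ x (by simp; linarith)
        · rw [abs_mul]
          exact (mul_le_mul_of_nonneg_right (hac i) (abs_nonneg t)).trans hc.le
    _ < η / (V * t ^ 2 + 1) * (V * t ^ 2 + 1) := by gcongr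
    _ = η := div_mul_cancel₀ η hVt.ne'

end WeakConvergence

section StochasticIntegral

variable {Ω : Type*} [MeasurableSpace Ω] {P : Measure Ω} {m : Measure ℝ} {B : Set ℝ → Ω → ℝ}

namespace IsGaussianRandomMeasure

lemma isProbabilityMeasure (hB : IsGaussianRandomMeasure P m B) : IsProbabilityMeasure P :=
  (hB.hasLaw ∅ .empty (by simp)).isProbabilityMeasure

lemma memLp_two (hB : IsGaussianRandomMeasure P m B) {A : Set ℝ} (hA : MeasurableSet A)
    (hmA : m A < ⊤) : MemLp (B A) 2 P :=
  (hB.hasLaw A hA hmA).hasGaussianLaw.memLp_two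

lemma empty_ae_eq (hB : IsGaussianRandomMeasure P m B) : B ∅ =ᵐ[P] fun _ => 0 := by
  have h := hB.hasLaw ∅ .empty (by simp)
  simp only [measure_empty, ENNReal.toNNReal_zero, gaussianReal_zero_var] at h
  exact h.ae_eq_of_dirac

lemma union_ae_eq (hB : IsGaussianRandomMeasure P m B) {A A' : Set ℝ}
    (hA : MeasurableSet A) (hA' : MeasurableSet A') (hmA : m A < ⊤) (hmA' : m A' < ⊤)
    (hd : Disjoint A A') : B (A ∪ A') =ᵐ[P] B A + B A' := by
  let S : ℕ → Set ℝ
    | 0 => A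
    | 1 => A'
    | _ => ∅
  have hS_union : ⋃ i, S i = A ∪ A' := by
    rw [← Set.union_iUnion_nat_succ, ← Set.union_iUnion_nat_succ]
    simp [S]
  have hS_disjoint : Pairwise fun i j => Disjoint (S i) (S j) := by
    rintro (_ | _ | i) (_ | _ | j) hij <;> simp_all [S, hd.symm]
  have hmU : m (A ∪ A') < ⊤ := measure_union_lt_top hmA hmA'
  have h_tendsto := hB.sigmaAdditive S (by rintro (_ | _ | i) <;> simp [S, hA, hA'])
    (by rwa [hS_union]) hS_disjoint
  have h_const : ∀ᶠ N in atTop,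
      eLpNorm (fun ω => B (⋃ i, S i) ω - ∑ i ∈ Finset.range N, B (S i) ω) 2 P
        = eLpNorm (B (A ∪ A') - (B A + B A')) 2 P := by
    filter_upwards [eventually_ge_atTop 2] with N hN
    refine eLpNorm_congr_ae ?_
    filter_upwards [hB.empty_ae_eq] with ω hω
    obtain ⟨k, rfl⟩ := Nat.exists_eq_add_of_le' hN
    rw [hS_union, Finset.sum_range_succ', Finset.sum_range_succ']
    simp [S, hω, add_comm]
  have h_zero := tendsto_nhds_unique (h_tendsto.congr' h_const) tendsto_const_nhds
  have hm := ((hB.memLp_two (hA.union hA') hmU).sub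
    ((hB.memLp_two hA hmA).add (hB.memLp_two hA' hmA'))).aestronglyMeasurable
  filter_upwards [(eLpNorm_eq_zero_iff hm two_ne_zero).1 h_zero.symm] with ω hω
  exact sub_eq_zero.1 hω

lemma iIndepFun_of_countable (hB : IsGaussianRandomMeasure P m B)
    {ι : Type*} [Countable ι] {A : ι → Set ℝ} (hA : ∀ i, MeasurableSet (A i))
    (hm : ∀ i, m (A i) < ⊤) (hd : Pairwise fun i j => Disjoint (A i) (A j)) :
    iIndepFun (fun i => B (A i)) P := by
  obtain ⟨f, hf⟩ := exists_injective_nat ι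
  let S : ℕ → Set ℝ := Function.extend f A fun _ => ∅
  have hS (i : ι) : S (f i) = A i := hf.extend_apply _ _ _
  have hS_cases (k : ℕ) : (∃ i, f i = k) ∨ S k = ∅ := by
    by_cases hk : ∃ i, f i = k
    · exact Or.inl hk
    · exact Or.inr (Function.extend_apply' _ _ _ hk)
  have hS_indep : iIndepFun (fun k => B (S k)) P := by
    refine hB.indep S (fun k => ?_) (fun k => ?_) fun k l hkl => ?_
    · rcases hS_cases k with ⟨i, rfl⟩ | hk
      · exact (hS i).symm ▸ hA i
      · exact hk.symm ▸ .empty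
    · rcases hS_cases k with ⟨i, rfl⟩ | hk
      · exact (hS i).symm ▸ hm i
      · simp [hk]
    · rcases hS_cases k with ⟨i, rfl⟩ | hk
      · rcases hS_cases l with ⟨j, rfl⟩ | hl
        · rw [hS, hS]
          exact hd (fun hij => hkl (congrArg f hij))
        · simp [hl]
      · simp [hk]
  simpa only [Function.comp_def, hS] using hS_indep.precomp hf

end IsGaussianRandomMeasure

open Classical in
/-- The vector measure `s ↦ B s` in `L²(P)`, with values acting on scalars so that
`SimpleFunc.setToSimpleFunc` applies to it; sets at which `B` is not square integrable are
sent to `0`. -/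
noncomputable def toLpMeasure (P : Measure Ω) (B : Set ℝ → Ω → ℝ) (s : Set ℝ) : ℝ →L[ℝ] Lp ℝ 2 P :=
  ContinuousLinearMap.toSpanSingleton ℝ (if h : MemLp (B s) 2 P then h.toLp (B s) else 0)

lemma toLpMeasure_apply {s : Set ℝ} (hs : MemLp (B s) 2 P) (c : ℝ) :
    toLpMeasure P B s c = c • hs.toLp (B s) := by
  simp [toLpMeasure, hs]

lemma IsGaussianRandomMeasure.finMeasAdditive (hB : IsGaussianRandomMeasure P m B) :
    FinMeasAdditive m (toLpMeasure P B) := by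
  intro s t hs ht hms hmt hd
  have hBs := hB.memLp_two hs hms.lt_top
  have hBt := hB.memLp_two ht hmt.lt_top
  have hBst := hB.memLp_two (hs.union ht) (measure_union_lt_top hms.lt_top hmt.lt_top)
  ext1
  simp only [_root_.add_apply, toLpMeasure_apply hBs, toLpMeasure_apply hBt,
    toLpMeasure_apply hBst, one_smul, ← MemLp.toLp_add]
  exact MemLp.toLp_congr _ _ (hB.union_ae_eq hs ht hms.lt_top hmt.lt_top hd)

lemma IsGaussianRandomMeasure.memLp_two_fiber (hB : IsGaussianRandomMeasure P m B)
    {φ : SimpleFunc ℝ ℝ} (hφ : MemLp φ 2 m) {c : ℝ} (hc : c ≠ 0) : MemLp (B (φ ⁻¹' {c})) 2 P :=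
  hB.memLp_two (φ.measurableSet_fiber c)
    (SimpleFunc.measure_preimage_lt_top_of_memLp two_ne_zero ENNReal.ofNat_ne_top φ hφ c hc)

lemma simpleIntegral_ae_eq_setToSimpleFunc (hB : IsGaussianRandomMeasure P m B)
    {φ : SimpleFunc ℝ ℝ} (hφ : MemLp φ 2 m) :
    simpleIntegral B φ =ᵐ[P] ⇑(φ.setToSimpleFunc (toLpMeasure P B)) := by
  rw [SimpleFunc.setToSimpleFunc_eq_sum_filter]
  refine EventuallyEq.trans ?_ (Lp.coeFn_finsetSum _ _).symm
  have h : ∀ᵐ ω ∂P, ∀ c ∈ φ.range.filter (fun c => c ≠ 0),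
      toLpMeasure P B (φ ⁻¹' {c}) c ω = c * B (φ ⁻¹' {c}) ω := by
    rw [Finset.eventually_all]
    intro c hc
    have hBc := hB.memLp_two_fiber hφ (Finset.mem_filter.1 hc).2
    rw [toLpMeasure_apply hBc]
    filter_upwards [Lp.coeFn_smul c (hBc.toLp _), hBc.coeFn_toLp] with ω h_smul h_toLp
    rw [h_smul, Pi.smul_apply, h_toLp, smul_eq_mul]
  filter_upwards [h] with ω hω
  rw [Finset.sum_apply]
  exact Finset.sum_congr rfl fun c hc => (hω c hc).symm

lemma memLp_simpleIntegral (hB : IsGaussianRandomMeasure P m B) {φ : SimpleFunc ℝ ℝ}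
    (hφ : MemLp φ 2 m) : MemLp (simpleIntegral B φ) 2 P :=
  (memLp_congr_ae (simpleIntegral_ae_eq_setToSimpleFunc hB hφ)).2 (Lp.memLp _)

lemma simpleIntegral_add_ae_eq (hB : IsGaussianRandomMeasure P m B) {φ ψ : SimpleFunc ℝ ℝ}
    (hφ : MemLp φ 2 m) (hψ : MemLp ψ 2 m) :
    simpleIntegral B (φ + ψ) =ᵐ[P] simpleIntegral B φ + simpleIntegral B ψ := by
  have h_add := SimpleFunc.setToSimpleFunc_add (toLpMeasure P B) hB.finMeasAdditive
    ((SimpleFunc.memLp_iff_integrable two_ne_zero ENNReal.ofNat_ne_top).1 hφ)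
    ((SimpleFunc.memLp_iff_integrable two_ne_zero ENNReal.ofNat_ne_top).1 hψ)
  have h_sum := simpleIntegral_ae_eq_setToSimpleFunc hB (φ := φ + ψ) (hφ.add hψ)
  rw [h_add] at h_sum
  exact h_sum.trans ((Lp.coeFn_add _ _).trans
    ((simpleIntegral_ae_eq_setToSimpleFunc hB hφ).add
      (simpleIntegral_ae_eq_setToSimpleFunc hB hψ)).symm)

lemma simpleIntegral_smul_ae_eq (hB : IsGaussianRandomMeasure P m B) {φ : SimpleFunc ℝ ℝ}
    (hφ : MemLp φ 2 m) (c : ℝ) :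
    simpleIntegral B (c • φ) =ᵐ[P] c • simpleIntegral B φ := by
  have h_smul := SimpleFunc.setToSimpleFunc_smul_real (toLpMeasure P B) hB.finMeasAdditive c
    ((SimpleFunc.memLp_iff_integrable two_ne_zero ENNReal.ofNat_ne_top).1 hφ)
  have h_integral := simpleIntegral_ae_eq_setToSimpleFunc hB (φ := c • φ) (hφ.const_smul c)
  rw [h_smul] at h_integral
  exact h_integral.trans ((Lp.coeFn_smul _ _).trans
    ((simpleIntegral_ae_eq_setToSimpleFunc hB hφ).const_smul c).symm)

namespace IsStochasticIntegral

variable {f g : ℝ → ℝ} {X Y : Ω → ℝ}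

lemma zero : IsStochasticIntegral P m B 0 0 := by
  refine ⟨MemLp.zero, MemLp.zero, fun _ => 0, fun _ => MemLp.zero, ?_, ?_⟩
  · simp
  · simp [simpleIntegral, Finset.filter_singleton]

lemma add (hB : IsGaussianRandomMeasure P m B) (hX : IsStochasticIntegral P m B f X)
    (hY : IsStochasticIntegral P m B g Y) : IsStochasticIntegral P m B (f + g) (X + Y) := by
  obtain ⟨hf, hX2, φ, hφ, hφ_lim, hX_lim⟩ := hX
  obtain ⟨hg, hY2, ψ, hψ, hψ_lim, hY_lim⟩ := hY
  refine ⟨hf.add hg, hX2.add hY2, φ + ψ, fun k => (hφ k).add (hψ k), ?_, ?_⟩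
  · refine tendsto_of_tendsto_of_tendsto_of_le_of_le tendsto_const_nhds
      (by simpa using hφ_lim.add hψ_lim) (fun _ => zero_le) fun k => ?_
    refine le_of_eq_of_le (eLpNorm_congr_ae (Eventually.of_forall fun y => ?_)) (eLpNorm_add_le
      (hf.sub (hφ k)).aestronglyMeasurable (hg.sub (hψ k)).aestronglyMeasurable one_le_two)
    simp [add_sub_add_comm]
  · refine tendsto_of_tendsto_of_tendsto_of_le_of_le tendsto_const_nhds
      (by simpa using hX_lim.add hY_lim) (fun _ => zero_le) fun k => ?_
    refine le_of_eq_of_le (eLpNorm_congr_ae ?_) (eLpNorm_add_le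
      (hX2.sub (memLp_simpleIntegral hB (hφ k))).aestronglyMeasurable
      (hY2.sub (memLp_simpleIntegral hB (hψ k))).aestronglyMeasurable one_le_two)
    filter_upwards [simpleIntegral_add_ae_eq hB (hφ k) (hψ k)] with ω hω
    simp [hω, add_sub_add_comm]

lemma const_smul (hB : IsGaussianRandomMeasure P m B) (hX : IsStochasticIntegral P m B f X)
    (c : ℝ) : IsStochasticIntegral P m B (c • f) (c • X) := by
  obtain ⟨hf, hX2, φ, hφ, hφ_lim, hX_lim⟩ := hX
  refine ⟨hf.const_smul c, hX2.const_smul c, fun k => c • φ k, fun k => (hφ k).const_smul c,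
    ?_, ?_⟩
  · have h_smul (k : ℕ) : eLpNorm (fun y => (c • f) y - (c • φ k) y) 2 m =
        ‖c‖ₑ * eLpNorm (fun y => f y - φ k y) 2 m := by
      rw [← eLpNorm_const_smul]
      congr 1 with y
      simp [mul_sub]
    simp only [h_smul]
    simpa using ENNReal.Tendsto.const_mul (a := ‖c‖ₑ) hφ_lim (Or.inr enorm_ne_top)
  · have h_smul (k : ℕ) : eLpNorm (fun ω => (c • X) ω - simpleIntegral B (c • φ k) ω) 2 P =
        ‖c‖ₑ * eLpNorm (fun ω => X ω - simpleIntegral B (φ k) ω) 2 P := by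
      rw [← eLpNorm_const_smul]
      refine eLpNorm_congr_ae ?_
      filter_upwards [simpleIntegral_smul_ae_eq hB (hφ k) c] with ω hω
      simp [hω, mul_sub]
    simp only [h_smul]
    simpa using ENNReal.Tendsto.const_mul (a := ‖c‖ₑ) hX_lim (Or.inr enorm_ne_top)

lemma sum_smul (hB : IsGaussianRandomMeasure P m B) {ι : Type*} (s : Finset ι) (u : ι → ℝ)
    {f : ι → ℝ → ℝ} {X : ι → Ω → ℝ} (hX : ∀ i, IsStochasticIntegral P m B (f i) (X i)) :
    IsStochasticIntegral P m B (∑ i ∈ s, u i • f i) (∑ i ∈ s, u i • X i) := by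
  classical
  induction s using Finset.induction_on with
  | empty => exact zero
  | insert i s hi ih =>
    rw [Finset.sum_insert hi, Finset.sum_insert hi]
    exact add hB (const_smul hB (hX i) (u i)) ih

end IsStochasticIntegral

lemma hasLaw_sum_gaussianReal {ι : Type*} [Fintype ι] {X : ι → Ω → ℝ} (hindep : iIndepFun X P)
    {μ : ι → ℝ} {v : ι → NNReal} (hX : ∀ i, HasLaw (X i) (gaussianReal (μ i) (v i)) P) :
    HasLaw (fun ω => ∑ i, X i ω) (gaussianReal (∑ i, μ i) (∑ i, v i)) P where
  aemeasurable := Finset.aemeasurable_fun_sum _ fun i _ => (hX i).aemeasurable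
  map_eq := by
    have := hindep.isProbabilityMeasure
    have := Measure.isProbabilityMeasure_map
      (Finset.aemeasurable_fun_sum Finset.univ fun i _ => (hX i).aemeasurable)
    refine Measure.ext_of_charFun (funext fun t => ?_)
    rw [hindep.charFun_map_fun_sum_eq_prod fun i => (hX i).aemeasurable, Finset.prod_apply]
    simp only [(hX _).map_eq, charFun_gaussianReal, ← Complex.exp_sum]
    congr 1
    push_cast
    simp only [Finset.sum_sub_distrib, Finset.mul_sum, Finset.sum_mul, Finset.sum_div]

lemma integral_sq_simpleFunc {φ : SimpleFunc ℝ ℝ} (hφ : MemLp φ 2 m) :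
    ∫ y, φ y ^ 2 ∂m = ∑ c ∈ φ.range.filter (fun c => c ≠ 0), c ^ 2 * m.real (φ ⁻¹' {c}) := by
  have h_sq : Integrable (φ.map (· ^ 2)) m := hφ.integrable_sq
  calc ∫ y, φ y ^ 2 ∂m = (φ.map (· ^ 2)).integral m :=
        (SimpleFunc.integral_eq_integral _ h_sq).symm
    _ = ∑ c ∈ φ.range, m.real (φ ⁻¹' {c}) • c ^ 2 :=
        φ.map_integral (· ^ 2)
          ((SimpleFunc.memLp_iff_integrable two_ne_zero ENNReal.ofNat_ne_top).1 hφ) (by simp)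
    _ = ∑ c ∈ φ.range.filter (fun c => c ≠ 0), c ^ 2 * m.real (φ ⁻¹' {c}) := by
        simp only [smul_eq_mul, mul_comm]
        exact (Finset.sum_filter_of_ne fun c _ h => by rintro rfl; simp at h).symm

lemma hasLaw_simpleIntegral (hB : IsGaussianRandomMeasure P m B) {φ : SimpleFunc ℝ ℝ}
    (hφ : MemLp φ 2 m) :
    HasLaw (simpleIntegral B φ) (gaussianReal 0 (∫ y, φ y ^ 2 ∂m).toNNReal) P := by
  let L : Finset ℝ := φ.range.filter fun c => c ≠ 0
  have hm (c : L) : m (φ ⁻¹' {c.1}) < ⊤ := SimpleFunc.measure_preimage_lt_top_of_memLp two_ne_zero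
    ENNReal.ofNat_ne_top φ hφ c (Finset.mem_filter.1 c.2).2
  have hd : Pairwise fun c d : L => Disjoint (φ ⁻¹' {c.1}) (φ ⁻¹' {d.1}) := fun c d hcd =>
    Disjoint.preimage _ (Set.disjoint_singleton.2 fun h => hcd (Subtype.ext h))
  have h_indep : iIndepFun (fun (c : L) ω => c.1 * B (φ ⁻¹' {c.1}) ω) P :=
    (hB.iIndepFun_of_countable (fun c : L => φ.measurableSet_fiber c) hm hd).comp
      (fun c x => c.1 * x) fun c => by fun_prop
  have h_law := hasLaw_sum_gaussianReal h_indep fun c =>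
    gaussianReal_const_mul (hB.hasLaw _ (φ.measurableSet_fiber c) (hm c)) c
  convert! h_law using 1
  · ext ω
    exact (Finset.sum_coe_sort L fun c => c * B (φ ⁻¹' {c}) ω).symm
  · congr 1
    · simp
    · refine NNReal.eq ?_
      rw [Real.coe_toNNReal _ (integral_nonneg fun y => sq_nonneg _), integral_sq_simpleFunc hφ,
        ← Finset.sum_coe_sort]
      simp [L, Measure.real, ENNReal.toReal]

lemma tendsto_integral_sq_of_tendsto_eLpNorm {X : Type*} [MeasurableSpace X] {μ : Measure X}
    {f : X → ℝ} {F : ℕ → X → ℝ} (hf : MemLp f 2 μ) (hF : ∀ k, MemLp (F k) 2 μ)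
    (h : Tendsto (fun k => eLpNorm (F k - f) 2 μ) atTop (𝓝 0)) :
    Tendsto (fun k => ∫ x, F k x ^ 2 ∂μ) atTop (𝓝 (∫ x, f x ^ 2 ∂μ)) := by
  have h_norm_sq {g : X → ℝ} (hg : MemLp g 2 μ) : ∫ x, g x ^ 2 ∂μ = ‖hg.toLp g‖ ^ 2 := by
    rw [← real_inner_self_eq_norm_sq, L2.inner_def]
    refine integral_congr_ae ?_
    filter_upwards [hg.coeFn_toLp] with x hx
    simp [hx, sq]
  simp_rw [h_norm_sq hf, fun k => h_norm_sq (hF k)]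
  exact ((Lp.tendsto_Lp_iff_tendsto_eLpNorm'' _ hF _ hf).2 h).norm.pow 2

/-- The **Itô isometry** for the Gaussian stochastic integral. -/
theorem IsStochasticIntegral.hasLaw (hB : IsGaussianRandomMeasure P m B) {f : ℝ → ℝ} {X : Ω → ℝ}
    (hX : IsStochasticIntegral P m B f X) :
    HasLaw X (gaussianReal 0 (∫ y, f y ^ 2 ∂m).toNNReal) P := by
  have := hB.isProbabilityMeasure
  obtain ⟨hf, hX2, φ, hφ, hφ_lim, hX_lim⟩ := hX
  have hI (k) : MemLp (simpleIntegral B (φ k)) 2 P := memLp_simpleIntegral hB (hφ k)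
  have h_var : Tendsto (fun k => ∫ y, φ k y ^ 2 ∂m) atTop (𝓝 (∫ y, f y ^ 2 ∂m)) :=
    tendsto_integral_sq_of_tendsto_eLpNorm hf hφ
      (hφ_lim.congr fun k => eLpNorm_sub_comm f (φ k) 2 m)
  have h_distr : TendstoInDistribution (fun k => simpleIntegral B (φ k)) atTop X (fun _ => P) P :=
    (tendstoInMeasure_of_tendsto_eLpNorm two_ne_zero (fun k => (hI k).aestronglyMeasurable)
      hX2.aestronglyMeasurable
      (hX_lim.congr fun k => eLpNorm_sub_comm X _ 2 P)).tendstoInDistribution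
        fun k => (hI k).aestronglyMeasurable.aemeasurable
  refine ⟨hX2.aestronglyMeasurable.aemeasurable, ?_⟩
  have := Measure.isProbabilityMeasure_map hX2.aestronglyMeasurable.aemeasurable
  refine Measure.ext_of_charFun (funext fun t => ?_)
  refine tendsto_nhds_unique (tendsto_charFun_of_tendstoInDistribution h_distr t) ?_
  simp only [(hasLaw_simpleIntegral hB (hφ _)).map_eq, charFun_gaussianReal]
  have h_cont : Continuous fun v : ℝ =>
      Complex.exp (t * (0 : ℝ) * Complex.I - v.toNNReal * t ^ 2 / 2) := by fun_prop
  exact (h_cont.tendsto _).comp h_var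

end StochasticIntegral

section RoundedKernel

/-- The integrated kernel `y ↦ ∫₀ᵗ g(s - y) ds`. -/
noncomputable def integratedKernel (g : ℝ → ℝ) (t y : ℝ) : ℝ :=
  ∫ s in (0 : ℝ)..t, g (s - y)

/-- The integrated kernel of `g` at `y = m / n`, with the variable of integration rounded down to
the grid `n⁻¹ℤ`. -/
noncomputable def roundedKernel (g : ℝ → ℝ) (n : ℕ) (t : ℝ) (m : ℤ) : ℝ :=
  ∫ s in (0 : ℝ)..t, g (((⌊n * s⌋ : ℝ) - m) / n)

/-- `G (s - y)` dominates `g (s - y)` after `s` and `y` are rounded down to any of the grids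
`n⁻¹ℤ`. -/
def IsRoundingEnvelope (g G : ℝ → ℝ) : Prop :=
  ∀ n : ℕ, 1 ≤ n → ∀ s y : ℝ, ‖g (((⌊n * s⌋ : ℝ) - ⌊n * y⌋) / n)‖ ≤ G (s - y)

variable {g G : ℝ → ℝ} {t : ℝ}

lemma IsRoundingEnvelope.nonneg (h : IsRoundingEnvelope g G) (x : ℝ) : 0 ≤ G x := by
  simpa using (norm_nonneg _).trans (h 1 le_rfl x 0)

lemma integratedKernel_le_integral (hG : Integrable G) (hG0 : ∀ x, 0 ≤ G x) (ht : 0 ≤ t) (y : ℝ) :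
    integratedKernel G t y ≤ ∫ x, G x := by
  rw [← integral_sub_right_eq_self (μ := volume) G y, integratedKernel,
    intervalIntegral.integral_of_le ht]
  exact setIntegral_le_integral (hG.comp_sub_right y) (Eventually.of_forall fun _ => hG0 _)

lemma integrable_integratedKernel (hG : Integrable G) (ht : 0 ≤ t) :
    Integrable (integratedKernel G t) := by
  have h_indicator : Integrable ((Set.Ioc 0 t).indicator fun _ : ℝ => (1 : ℝ)) :=
    (integrable_indicator_iff measurableSet_Ioc).2 (integrableOn_const (by simp))
  refine (h_indicator.integrable_convolution (ContinuousLinearMap.mul ℝ ℝ) hG.comp_neg).congr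
    (Eventually.of_forall fun y => ?_)
  simp only [integratedKernel, convolution, ContinuousLinearMap.mul_apply', neg_sub]
  rw [intervalIntegral.integral_of_le ht, ← integral_indicator measurableSet_Ioc]
  congr 1 with s
  by_cases hs : s ∈ Set.Ioc 0 t <;> simp [hs]

lemma tendsto_floor_mul_div (s : ℝ) :
    Tendsto (fun n : ℕ => (⌊(n : ℝ) * s⌋ : ℝ) / n) atTop (𝓝 s) := by
  have h_lower : Tendsto (fun n : ℕ => s - 1 / (n : ℝ)) atTop (𝓝 s) := by
    simpa using tendsto_const_nhds (x := s).sub tendsto_one_div_atTop_nhds_zero_nat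
  refine tendsto_of_tendsto_of_tendsto_of_le_of_le' h_lower tendsto_const_nhds ?_ ?_
  · filter_upwards [eventually_gt_atTop 0] with n hn
    have hn0 : (0 : ℝ) < n := by exact_mod_cast hn
    rw [le_div_iff₀ hn0, sub_mul, one_div, inv_mul_cancel₀ hn0.ne']
    linarith [Int.lt_floor_add_one (n * s)]
  · filter_upwards [eventually_gt_atTop 0] with n hn
    have hn0 : (0 : ℝ) < n := by exact_mod_cast hn
    rw [div_le_iff₀ hn0]
    linarith [Int.floor_le (n * s)]

lemma abs_roundedKernel_floor_le (h : IsRoundingEnvelope g G) (hG : Integrable G) {n : ℕ}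
    (hn : 1 ≤ n) (ht : 0 ≤ t) (y : ℝ) :
    |roundedKernel g n t ⌊n * y⌋| ≤ integratedKernel G t y :=
  intervalIntegral.norm_integral_le_of_norm_le ht (Eventually.of_forall fun s _ => h n hn s y)
    (hG.comp_sub_right y).intervalIntegrable

lemma abs_roundedKernel_le (h : IsRoundingEnvelope g G) (hG : Integrable G) {n : ℕ}
    (hn : 1 ≤ n) (ht : 0 ≤ t) (m : ℤ) : |roundedKernel g n t m| ≤ ∫ x, G x := by
  have hn0 : (n : ℝ) ≠ 0 := by positivity
  have h_floor := abs_roundedKernel_floor_le h hG hn ht (m / n)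
  rw [mul_div_cancel₀ _ hn0, Int.floor_intCast] at h_floor
  exact h_floor.trans (integratedKernel_le_integral hG h.nonneg ht _)

lemma tendsto_roundedKernel (h : IsRoundingEnvelope g G) (hG : Integrable G)
    (hg : ∀ᵐ x, ContinuousAt g x) (t y : ℝ) :
    Tendsto (fun n : ℕ => roundedKernel g n t ⌊n * y⌋) atTop (𝓝 (integratedKernel g t y)) := by
  refine intervalIntegral.tendsto_integral_filter_of_dominated_convergence (fun s => G (s - y))
    (Eventually.of_forall fun n => ?_) ?_ (hG.comp_sub_right y).intervalIntegrable ?_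
  · have h_int : Measurable fun k : ℤ => g (((k : ℝ) - ⌊n * y⌋) / n) := measurable_from_top
    exact (h_int.comp (show Measurable fun s : ℝ => ⌊n * s⌋ by fun_prop)).aestronglyMeasurable
  · filter_upwards [eventually_ge_atTop 1] with n hn
    exact Eventually.of_forall fun s _ => h n hn s y
  · filter_upwards [(measurePreserving_sub_right volume y).quasiMeasurePreserving.ae hg]
      with s hs _
    have h_lim := (tendsto_floor_mul_div s).sub (tendsto_floor_mul_div y)
    simp_rw [← sub_div] at h_lim
    exact hs.tendsto.comp h_lim

variable {ι : Type*} [Fintype ι] {τ : ι → ℝ}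

lemma abs_sum_mul_roundedKernel_floor_le (h : IsRoundingEnvelope g G) (hG : Integrable G)
    (hτ : ∀ r, 0 ≤ τ r) (u : ι → ℝ) {n : ℕ} (hn : 1 ≤ n) (y : ℝ) :
    |∑ r, u r * roundedKernel g n (τ r) ⌊n * y⌋| ≤
      ∑ r, |u r| * integratedKernel G (τ r) y := by
  refine (Finset.abs_sum_le_sum_abs _ _).trans (Finset.sum_le_sum fun r _ => ?_)
  rw [abs_mul]
  exact mul_le_mul_of_nonneg_left (abs_roundedKernel_floor_le h hG hn (hτ r) y) (abs_nonneg _)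

lemma abs_sum_mul_roundedKernel_le (h : IsRoundingEnvelope g G) (hG : Integrable G)
    (hτ : ∀ r, 0 ≤ τ r) (u : ι → ℝ) {n : ℕ} (hn : 1 ≤ n) (m : ℤ) :
    |∑ r, u r * roundedKernel g n (τ r) m| ≤ ∑ r, |u r| * ∫ x, G x := by
  refine (Finset.abs_sum_le_sum_abs _ _).trans (Finset.sum_le_sum fun r _ => ?_)
  rw [abs_mul]
  exact mul_le_mul_of_nonneg_left (abs_roundedKernel_le h hG hn (hτ r) m) (abs_nonneg _)

lemma sq_sum_mul_roundedKernel_floor_le (h : IsRoundingEnvelope g G) (hG : Integrable G)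
    (hτ : ∀ r, 0 ≤ τ r) (u : ι → ℝ) {n : ℕ} (hn : 1 ≤ n) (y : ℝ) :
    ‖(∑ r, u r * roundedKernel g n (τ r) ⌊n * y⌋) ^ 2‖ ≤
      (∑ r, |u r| * ∫ x, G x) * ∑ r, |u r| * integratedKernel G (τ r) y := by
  have h_bound := abs_sum_mul_roundedKernel_le h hG hτ u hn ⌊n * y⌋
  rw [norm_pow, sq, Real.norm_eq_abs]
  exact mul_le_mul h_bound (abs_sum_mul_roundedKernel_floor_le h hG hτ u hn y) (abs_nonneg _)
    ((abs_nonneg _).trans h_bound)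

lemma integrable_const_mul_sum_integratedKernel (hG : Integrable G) (hτ : ∀ r, 0 ≤ τ r)
    (c : ℝ) (u : ι → ℝ) : Integrable fun y => c * ∑ r, u r * integratedKernel G (τ r) y :=
  (integrable_finsetSum _ fun r _ =>
    (integrable_integratedKernel hG (hτ r)).const_mul _).const_mul _

lemma measurable_comp_floor_mul (F : ℤ → ℝ) (c : ℝ) : Measurable fun y : ℝ => F ⌊c * y⌋ :=
  (measurable_from_top (f := F)).comp (by fun_prop)

lemma integrable_sq_sum_mul_roundedKernel (h : IsRoundingEnvelope g G) (hG : Integrable G)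
    (hτ : ∀ r, 0 ≤ τ r) (u : ι → ℝ) {n : ℕ} (hn : 1 ≤ n) :
    Integrable fun y : ℝ => (∑ r, u r * roundedKernel g n (τ r) ⌊n * y⌋) ^ 2 :=
  (integrable_const_mul_sum_integratedKernel hG hτ _ _).mono'
    (measurable_comp_floor_mul
      (fun m => (∑ r, u r * roundedKernel g n (τ r) m) ^ 2) n).aestronglyMeasurable
    (Eventually.of_forall (sq_sum_mul_roundedKernel_floor_le h hG hτ u hn))

lemma tendsto_integral_sq_sum_mul_roundedKernel (h : IsRoundingEnvelope g G) (hG : Integrable G)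
    (hg : ∀ᵐ x, ContinuousAt g x) (hτ : ∀ r, 0 ≤ τ r) (u : ι → ℝ) :
    Tendsto (fun n : ℕ => ∫ y : ℝ, (∑ r, u r * roundedKernel g n (τ r) ⌊n * y⌋) ^ 2) atTop
      (𝓝 (∫ y, (∑ r, u r * integratedKernel g (τ r) y) ^ 2)) := by
  refine tendsto_integral_filter_of_dominated_convergence _
    (Eventually.of_forall fun n => (measurable_comp_floor_mul
      (fun m => (∑ r, u r * roundedKernel g n (τ r) m) ^ 2) n).aestronglyMeasurable) ?_
    (integrable_const_mul_sum_integratedKernel hG hτ (∑ r, |u r| * ∫ x, G x) fun r => |u r|) ?_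
  · filter_upwards [eventually_ge_atTop 1] with n hn
    exact Eventually.of_forall (sq_sum_mul_roundedKernel_floor_le h hG hτ u hn)
  · exact Eventually.of_forall fun y => (tendsto_finsetSum _ fun r _ =>
      (tendsto_roundedKernel h hG hg (τ r) y).const_mul (u r)).pow 2

end RoundedKernel

section TemperedPower

variable {β lam : ℝ}

lemma temperedPower_nonneg (β lam x : ℝ) : 0 ≤ temperedPower β lam x := by
  unfold temperedPower
  split_ifs <;> positivity

lemma integrable_temperedPower (hβ : -1 < β) (hlam : 0 < lam) :
    Integrable (temperedPower β lam) := by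
  have h_indicator : temperedPower β lam =
      (Set.Ioi 0).indicator fun x : ℝ => x ^ β * Real.exp (-lam * x) := by
    ext x
    simp [temperedPower, Set.indicator_apply]
  rw [h_indicator, integrable_indicator_iff measurableSet_Ioi]
  simpa using integrableOn_rpow_mul_exp_neg_mul_rpow (p := 1) hβ one_pos hlam

lemma continuousAt_temperedPower (β lam : ℝ) {x : ℝ} (hx : x ≠ 0) :
    ContinuousAt (temperedPower β lam) x := by
  rcases hx.lt_or_gt with hneg | hpos
  · refine (continuousAt_const (y := (0 : ℝ))).congr ?_
    filter_upwards [Iio_mem_nhds hneg] with y hy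
    exact (if_neg (not_lt.2 (le_of_lt hy))).symm
  · have h_cont : ContinuousAt (fun x : ℝ => x ^ β * Real.exp (-lam * x)) x :=
      (Real.continuousAt_rpow_const _ _ (Or.inl hx)).mul (by fun_prop)
    refine h_cont.congr ?_
    filter_upwards [Ioi_mem_nhds hpos] with y hy
    exact (if_pos hy).symm

/-- An integrable function of `x` that bounds `temperedPower β lam` on `[x / 2, x + 1]`, whatever
the sign of `β`. -/
noncomputable def temperedBound (β lam x : ℝ) : ℝ :=
  temperedPower β lam (x / 2) + Real.exp (lam / 2) * temperedPower β (lam / 2) (x + 1)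

lemma temperedBound_nonneg (β lam x : ℝ) : 0 ≤ temperedBound β lam x :=
  add_nonneg (temperedPower_nonneg _ _ _)
    (mul_nonneg (Real.exp_nonneg _) (temperedPower_nonneg _ _ _))

lemma integrable_temperedBound (hβ : -1 < β) (hlam : 0 < lam) :
    Integrable (temperedBound β lam) :=
  ((integrable_temperedPower hβ hlam).comp_div two_ne_zero).add
    (((integrable_temperedPower hβ (half_pos hlam)).comp_add_right 1).const_mul _)

lemma rpow_le_rpow_add_rpow {a b x : ℝ} (ha : 0 < a) (hax : a ≤ x) (hxb : x ≤ b) (β : ℝ) :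
    x ^ β ≤ a ^ β + b ^ β := by
  have hx : 0 < x := ha.trans_le hax
  rcases le_total 0 β with hβ | hβ
  · exact (Real.rpow_le_rpow hx.le hxb hβ).trans (le_add_of_nonneg_left (by positivity))
  · exact (Real.rpow_le_rpow_of_nonpos ha hax hβ).trans
      (le_add_of_nonneg_right (Real.rpow_nonneg (hx.le.trans hxb) β))

lemma temperedPower_le_temperedBound (hlam : 0 ≤ lam) {x z : ℝ} (hx : 0 < x) (hxz : x / 2 ≤ z)
    (hzx : z ≤ x + 1) : temperedPower β lam z ≤ temperedBound β lam x := by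
  have hx2 : 0 < x / 2 := half_pos hx
  have hx1 : 0 < x + 1 := by positivity
  have h_exp : Real.exp (-lam * z) ≤ Real.exp (-lam * (x / 2)) := by
    rw [Real.exp_le_exp]
    nlinarith
  have h_exp_split : Real.exp (-lam * (x / 2)) =
      Real.exp (lam / 2) * Real.exp (-(lam / 2) * (x + 1)) := by
    rw [← Real.exp_add]
    ring_nf
  simp only [temperedBound, temperedPower, hx2.trans_le hxz, hx2, hx1, if_true]
  calc z ^ β * Real.exp (-lam * z)
      ≤ ((x / 2) ^ β + (x + 1) ^ β) * Real.exp (-lam * (x / 2)) := by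
        gcongr
        exact rpow_le_rpow_add_rpow hx2 hxz hzx β
    _ = (x / 2) ^ β * Real.exp (-lam * (x / 2)) +
        (x + 1) ^ β * Real.exp (-lam * (x / 2)) := add_mul _ _ _
    _ = (x / 2) ^ β * Real.exp (-lam * (x / 2)) +
        Real.exp (lam / 2) * ((x + 1) ^ β * Real.exp (-(lam / 2) * (x + 1))) := by
      rw [h_exp_split]
      ring

lemma rounded_sub_mem_Icc {n : ℕ} (hn : 1 ≤ n) {s y : ℝ}
    (h : 0 < ((⌊n * s⌋ : ℝ) - ⌊n * y⌋) / n) :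
    0 < s - y ∧ ((⌊n * s⌋ : ℝ) - ⌊n * y⌋) / n ∈ Set.Icc ((s - y) / 2) (s - y + 1) := by
  have hn1 : (1 : ℝ) ≤ n := by exact_mod_cast hn
  have hn0 : (0 : ℝ) < n := by linarith
  rw [div_pos_iff_of_pos_right hn0] at h
  have h_one_le : (1 : ℝ) ≤ (⌊n * s⌋ : ℝ) - ⌊n * y⌋ := by
    have : (0 : ℤ) < ⌊n * s⌋ - ⌊n * y⌋ := by exact_mod_cast h
    exact_mod_cast this
  have hs_le := Int.floor_le (n * s)
  have hs_lt := Int.lt_floor_add_one (n * s)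
  have hy_le := Int.floor_le (n * y)
  have hy_lt := Int.lt_floor_add_one (n * y)
  refine ⟨pos_of_mul_pos_right (a := (n : ℝ)) (by linarith) hn0.le, ?_, ?_⟩
  · rw [le_div_iff₀ hn0]
    nlinarith
  · rw [div_le_iff₀ hn0]
    nlinarith

lemma isRoundingEnvelope_temperedPower (β : ℝ) (hlam : 0 ≤ lam) :
    IsRoundingEnvelope (temperedPower β lam) (temperedBound β lam) := by
  intro n hn s y
  rw [Real.norm_of_nonneg (temperedPower_nonneg _ _ _)]
  by_cases hpos : 0 < ((⌊n * s⌋ : ℝ) - ⌊n * y⌋) / n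
  · obtain ⟨hsy, h_lower, h_upper⟩ := rounded_sub_mem_Icc hn hpos
    exact temperedPower_le_temperedBound hlam hsy h_lower h_upper
  · exact (if_neg hpos).trans_le (temperedBound_nonneg _ _ _)

end TemperedPower

section Floor

lemma hasSum_of_integrable_comp_floor {F : ℤ → ℝ} (hF : Integrable fun y : ℝ => F ⌊y⌋) :
    HasSum F (∫ y : ℝ, F ⌊y⌋) := by
  have h := hasSum_integral_iUnion (μ := volume) (f := fun y : ℝ => F ⌊y⌋)
    (s := fun m : ℤ => Set.Ico (m : ℝ) (m + 1)) (fun m => measurableSet_Ico)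
    (Set.pairwise_disjoint_Ico_intCast ℝ) hF.integrableOn
  rw [iUnion_Ico_intCast, setIntegral_univ] at h
  refine h.congr_fun fun m => ?_
  have h_const : Set.EqOn (fun y : ℝ => F ⌊y⌋) (fun _ => F m) (Set.Ico (m : ℝ) (m + 1)) :=
    fun y hy => congrArg F (Int.floor_eq_iff.2 hy)
  rw [setIntegral_congr_fun measurableSet_Ico h_const]
  simp

lemma hasSum_of_integrable_comp_floor_mul {F : ℤ → ℝ} {c : ℝ} (hc : 0 < c)
    (hF : Integrable fun y : ℝ => F ⌊c * y⌋) :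
    HasSum (fun m => c⁻¹ * F m) (∫ y : ℝ, F ⌊c * y⌋) := by
  rw [Measure.integral_comp_mul_left (fun y : ℝ => F ⌊y⌋), smul_eq_mul,
    abs_of_nonneg (inv_nonneg.2 hc.le)]
  exact (hasSum_of_integrable_comp_floor
    ((integrable_comp_mul_left_iff (fun y : ℝ => F ⌊y⌋) hc.ne').1 hF)).mul_left _

lemma ae_comp_floor_eq (c : ℤ → ℝ) {k : ℕ} {b : ℝ} (hkb : (k : ℝ) ≤ b) (hb : b ≤ k + 1) :
    ∀ᵐ s : ℝ, s ∈ Set.uIoc (k : ℝ) b → c ⌊s⌋ = c k := by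
  filter_upwards [volume.ae_ne b] with s hs hmem
  rw [Set.uIoc_of_le hkb] at hmem
  have h_floor : ⌊s⌋ = (k : ℤ) :=
    Int.floor_eq_iff.2 ⟨by simpa using hmem.1.le,
      by simpa using (lt_of_le_of_ne hmem.2 hs).trans_le hb⟩
  rw [h_floor]

lemma intervalIntegrable_comp_floor (c : ℤ → ℝ) {k : ℕ} {b : ℝ} (hkb : (k : ℝ) ≤ b)
    (hb : b ≤ k + 1) : IntervalIntegrable (fun s : ℝ => c ⌊s⌋) volume k b := by
  refine (intervalIntegrable_const (c := c k)).congr_ae ?_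
  rw [EventuallyEq, ae_restrict_iff' measurableSet_uIoc]
  filter_upwards [ae_comp_floor_eq c hkb hb] with s hs hmem
  exact (hs hmem).symm

lemma integral_comp_floor_of_le_add_one (c : ℤ → ℝ) {k : ℕ} {b : ℝ} (hkb : (k : ℝ) ≤ b)
    (hb : b ≤ k + 1) : ∫ s in (k : ℝ)..b, c ⌊s⌋ = (b - k) * c k := by
  rw [intervalIntegral.integral_congr_ae (ae_comp_floor_eq c hkb hb)]
  simp

lemma integral_comp_floor (c : ℤ → ℝ) {x : ℝ} (hx : 0 ≤ x) :
    ∫ s in (0 : ℝ)..x, c ⌊s⌋ =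
      ∑ k ∈ Finset.range ⌊x⌋₊, c k + (x - ⌊x⌋₊) * c ⌊x⌋₊ := by
  have h_int (k : ℕ) : IntervalIntegrable (fun s : ℝ => c ⌊s⌋) volume (k : ℕ) (k + 1 : ℕ) :=
    intervalIntegrable_comp_floor c (by simp) (by simp)
  have h_sum := intervalIntegral.sum_integral_adjacent_intervals (n := ⌊x⌋₊)
    (a := fun k : ℕ => (k : ℝ)) (fun k _ => h_int k)
  have h_int_floor := IntervalIntegrable.trans_iterate (n := ⌊x⌋₊)
    (a := fun k : ℕ => (k : ℝ)) (fun k _ => h_int k)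
  have h_le := Nat.floor_le hx
  have h_lt := (Nat.lt_floor_add_one x).le
  rw [Nat.cast_zero] at h_int_floor h_sum
  rw [← intervalIntegral.integral_add_adjacent_intervals h_int_floor
    (intervalIntegrable_comp_floor c h_le h_lt), ← h_sum,
    integral_comp_floor_of_le_add_one c h_le h_lt]
  congr 1
  refine Finset.sum_congr rfl fun k _ => ?_
  rw [integral_comp_floor_of_le_add_one c (by simp) (by simp)]
  simp

end Floor

section MovingAverage

/-- The coefficient of the innovation `ζ i` in the interpolated partial sum up to `x` of the moving
average of `ζ` with coefficients `c`. -/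
noncomputable def partialSumWeight (c : ℤ → ℝ) (x : ℝ) (i : ℤ) : ℝ :=
  ∑ k ∈ Finset.Icc 1 ⌊x⌋₊, c ((k : ℤ) - i) + (x - (⌊x⌋₊ : ℝ)) * c ((⌊x⌋₊ : ℤ) + 1 - i)

lemma partialSumWeight_add_one (c : ℤ → ℝ) {x : ℝ} (hx : 0 ≤ x) (m : ℤ) :
    partialSumWeight c x (m + 1) = ∫ s in (0 : ℝ)..x, c (⌊s⌋ - m) := by
  rw [integral_comp_floor (fun k => c (k - m)) hx, partialSumWeight]
  congr 1
  · rw [Finset.range_eq_Ico, ← Finset.Ico_add_one_right_eq_Icc, ← zero_add 1,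
      ← Finset.sum_Ico_add']
    refine Finset.sum_congr rfl fun k _ => ?_
    push_cast
    ring_nf
  · ring_nf

lemma partialSumWeight_mul_add_one {c : ℤ → ℝ} {g : ℝ → ℝ} {A : ℝ} {n : ℕ} (hn : 1 ≤ n)
    (hc : ∀ j, c j = A * g (j / n)) {t : ℝ} (ht : 0 ≤ t) (m : ℤ) :
    partialSumWeight c (n * t) (m + 1) = n * A * roundedKernel g n t m := by
  have hn0 : (n : ℝ) ≠ 0 := by positivity
  calc partialSumWeight c (n * t) (m + 1)
      = ∫ s in (0 : ℝ)..n * t, c (⌊s⌋ - m) := partialSumWeight_add_one c (by positivity) m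
    _ = n * ∫ s in (0 : ℝ)..t, c (⌊n * s⌋ - m) := by
        rw [intervalIntegral.integral_comp_mul_left (fun s : ℝ => c (⌊s⌋ - m)) hn0, mul_zero,
          smul_eq_mul, mul_inv_cancel_left₀ hn0]
    _ = n * A * roundedKernel g n t m := by
        simp_rw [hc, intervalIntegral.integral_const_mul, Int.cast_sub, mul_assoc, roundedKernel]

lemma coeff_div_eq (α lam : ℝ) {n : ℕ} (hn : 1 ≤ n) (j : ℤ) :
    coeff α (lam / n) j =
      (n : ℝ) ^ (α - 1) / Real.Gamma α * temperedPower (α - 1) lam (j / n) := by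
  have hn0 : (0 : ℝ) < n := by exact_mod_cast hn
  by_cases hj : 1 ≤ j
  · have hj0 : (0 : ℝ) < j := by exact_mod_cast hj
    have h_div : (0 : ℝ) < j / n := by positivity
    have h_exp : -(lam / n) * (j : ℝ) = -lam * (j / n) := by ring
    have h_rpow : (n : ℝ) ^ (α - 1) ≠ 0 := (Real.rpow_pos_of_pos hn0 _).ne'
    simp only [coeff, temperedPower, hj, h_div, if_true, h_exp, Real.div_rpow hj0.le hn0.le]
    field_simp
  · have hj0 : (j : ℝ) ≤ 0 := by exact_mod_cast (by omega : j ≤ 0)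
    have h_div : ¬ (0 : ℝ) < j / n := not_lt.2 (div_nonpos_of_nonpos_of_nonneg hj0 hn0.le)
    simp [coeff, temperedPower, hj, h_div]

lemma rpow_mul_partialSumWeight_coeff (α lam : ℝ) {n : ℕ} (hn : 1 ≤ n) {t : ℝ} (ht : 0 ≤ t)
    (m : ℤ) :
    (n : ℝ) ^ (-(1 / 2 + α)) * partialSumWeight (coeff α (lam / n)) (n * t) (m + 1) =
      (n : ℝ) ^ (-(1 / 2) : ℝ) / Real.Gamma α *
        roundedKernel (temperedPower (α - 1) lam) n t m := by
  have hn0 : (0 : ℝ) < n := by exact_mod_cast hn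
  have h_rpow : (n : ℝ) ^ (-(1 / 2) : ℝ) =
      (n : ℝ) ^ (-(1 / 2 + α)) * (n * (n : ℝ) ^ (α - 1)) := by
    rw [Real.rpow_sub_one hn0.ne', mul_div_cancel₀ _ hn0.ne', ← Real.rpow_add hn0]
    ring_nf
  rw [partialSumWeight_mul_add_one hn (coeff_div_eq α lam hn) ht, h_rpow]
  ring

lemma summable_coeff (α : ℝ) {κ : ℝ} (hκ : 0 < κ) : Summable (coeff α κ) := by
  have h_support : ∀ j ∉ Set.range ((↑) : ℕ → ℤ), coeff α κ j = 0 := by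
    intro j hj
    refine if_neg fun hj1 => hj ⟨j.toNat, ?_⟩
    omega
  rw [← Nat.cast_injective.summable_iff h_support]
  refine Summable.of_norm_bounded
    ((Real.summable_pow_mul_exp_neg_nat_mul ⌈α⌉₊ hκ).mul_left |1 / Real.Gamma α|) fun j => ?_
  simp only [Function.comp_apply, coeff]
  split_ifs with hj
  · have hj1 : (1 : ℝ) ≤ j := by exact_mod_cast hj
    have h_rpow : (j : ℝ) ^ (α - 1) ≤ (j : ℝ) ^ ⌈α⌉₊ := by
      rw [← Real.rpow_natCast]
      exact Real.rpow_le_rpow_of_exponent_le hj1 (by linarith [Nat.le_ceil α])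
    rw [Real.norm_eq_abs, abs_mul, abs_mul, Real.abs_exp, mul_assoc, Int.cast_natCast,
      abs_of_nonneg (Real.rpow_nonneg (by linarith) _)]
    gcongr
  · rw [norm_zero]
    positivity

variable {Ω : Type*} [MeasurableSpace Ω] {P : Measure Ω} {μ : Measure ℝ}

lemma ae_summable_mul_of_hasLaw {ι : Type*} [Countable ι] {X : ι → Ω → ℝ}
    (hX : ∀ i, HasLaw (X i) μ P) (hμ : Integrable (fun x => x) μ) {a : ι → ℝ} (ha : Summable a) :
    ∀ᵐ ω ∂P, Summable fun i => a i * X i ω := by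
  have h_eLpNorm (i : ι) :
      eLpNorm (fun ω => a i * X i ω) 1 P = ‖a i‖ₑ * ∫⁻ x, ‖x‖ₑ ∂μ := by
    rw [eLpNorm_one_eq_lintegral_enorm, ← (hX i).lintegral_comp measurable_enorm.aemeasurable]
    simp_rw [enorm_mul]
    exact lintegral_const_mul'' _ (hX i).aemeasurable.enorm
  have h_tsum : ∑' i, eLpNorm (fun ω => a i * X i ω) 1 P ≠ ⊤ := by
    simp_rw [h_eLpNorm, ENNReal.tsum_mul_right]
    exact ENNReal.mul_ne_top (tsum_enorm_ne_top_iff_summable_norm.2 ha.norm) hμ.2.ne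
  filter_upwards [summable_norm_of_tsum_eLpNorm_ne_top le_rfl
    (fun i => ((hX i).aemeasurable.const_mul _).aestronglyMeasurable) h_tsum] with ω hω
  exact hω.of_norm

variable {ζ : ℤ → Ω → ℝ} {α κ : ℝ}

lemma ae_hasSum_movingAverage (hζ : ∀ i, HasLaw (ζ i) μ P) (hμ : Integrable (fun x => x) μ)
    (hκ : 0 < κ) :
    ∀ᵐ ω ∂P, ∀ k : ℤ,
      HasSum (fun i => coeff α κ (k - i) * ζ i ω) (movingAverage α κ ζ k ω) := by
  refine ae_all_iff.2 fun k => ?_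
  filter_upwards [ae_summable_mul_of_hasLaw (fun j => hζ (k - j)) hμ (summable_coeff α hκ)]
    with ω hω
  have h := hω.hasSum
  rw [← (Equiv.subLeft k).hasSum_iff] at h
  simpa [Function.comp_def, movingAverage] using h

lemma ae_hasSum_partialSum (hζ : ∀ i, HasLaw (ζ i) μ P) (hμ : Integrable (fun x => x) μ)
    (hκ : 0 < κ) :
    ∀ᵐ ω ∂P, ∀ x : ℝ,
      HasSum (fun i => partialSumWeight (coeff α κ) x i * ζ i ω) (partialSum α κ ζ x ω) := by
  filter_upwards [ae_hasSum_movingAverage hζ hμ hκ] with ω hω x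
  have h := (hasSum_sum fun (k : ℕ) (_ : k ∈ Finset.Icc 1 ⌊x⌋₊) => hω (k : ℤ)).add
    ((hω ((⌊x⌋₊ : ℤ) + 1)).mul_left (x - (⌊x⌋₊ : ℝ)))
  refine h.congr_fun fun i => ?_
  rw [partialSumWeight, add_mul, Finset.sum_mul, mul_assoc]

lemma aemeasurable_partialSum (hζ : ∀ i, HasLaw (ζ i) μ P) (hμ : Integrable (fun x => x) μ)
    (hκ : 0 < κ) (x : ℝ) : AEMeasurable (partialSum α κ ζ x) P := by
  refine aemeasurable_of_tendsto_metrizable_ae (atTop : Filter (Finset ℤ))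
    (fun s => Finset.aemeasurable_fun_sum s fun i _ =>
      (hζ i).aemeasurable.const_mul (partialSumWeight (coeff α κ) x i)) ?_
  filter_upwards [ae_hasSum_partialSum hζ hμ hκ] with ω hω
  exact hω x

lemma aemeasurable_rpow_mul_partialSum (hζ : ∀ i, HasLaw (ζ i) μ P)
    (hμ : Integrable (fun x => x) μ) {lam : ℝ} (hlam : 0 < lam) (H t : ℝ) (n : ℕ) :
    AEMeasurable (fun ω => (n : ℝ) ^ (-H) * partialSum α (lam / n) ζ (n * t) ω) P := by
  rcases n.eq_zero_or_pos with rfl | hn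
  · simp [partialSum]
  · exact (aemeasurable_partialSum hζ hμ (by positivity) _).const_mul _

end MovingAverage

section LinearCombination

variable {ι : Type*} [Fintype ι] {α lam : ℝ} {τ : ι → ℝ}

/-- The coefficient of the innovation `ζ i` in the linear combination `∑ r, u r * n⁻ᴴ Sₙ(n τ r)` of
normalized partial sums, where `H = 1 / 2 + α`. -/
noncomputable def combinedWeight (α lam : ℝ) (τ u : ι → ℝ) (n : ℕ) (i : ℤ) : ℝ :=
  ∑ r, u r * ((n : ℝ) ^ (-(1 / 2 + α)) * partialSumWeight (coeff α (lam / n)) (n * τ r) i)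

lemma combinedWeight_add_one (α lam : ℝ) (hτ : ∀ r, 0 ≤ τ r) (u : ι → ℝ) {n : ℕ} (hn : 1 ≤ n)
    (m : ℤ) :
    combinedWeight α lam τ u n (m + 1) = (n : ℝ) ^ (-(1 / 2) : ℝ) / Real.Gamma α *
      ∑ r, u r * roundedKernel (temperedPower (α - 1) lam) n (τ r) m := by
  simp only [combinedWeight, rpow_mul_partialSumWeight_coeff α lam hn (hτ _), Finset.mul_sum]
  exact Finset.sum_congr rfl fun r _ => mul_left_comm _ _ _

lemma abs_combinedWeight_le (hα : 0 < α) (hlam : 0 < lam) (hτ : ∀ r, 0 ≤ τ r) (u : ι → ℝ) {n : ℕ}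
    (hn : 1 ≤ n) (i : ℤ) :
    |combinedWeight α lam τ u n i| ≤ (n : ℝ) ^ (-(1 / 2) : ℝ) / Real.Gamma α *
      ∑ r, |u r| * ∫ x, temperedBound (α - 1) lam x := by
  obtain ⟨m, rfl⟩ : ∃ m, i = m + 1 := ⟨i - 1, by ring⟩
  rw [combinedWeight_add_one α lam hτ u hn, abs_mul, abs_of_nonneg (by positivity)]
  gcongr
  exact abs_sum_mul_roundedKernel_le (isRoundingEnvelope_temperedPower _ hlam.le)
    (integrable_temperedBound (by linarith) hlam) hτ u hn m

lemma tendsto_rpow_neg_half_div_mul (a b : ℝ) :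
    Tendsto (fun n : ℕ => (n : ℝ) ^ (-(1 / 2) : ℝ) / a * b) atTop (𝓝 0) := by
  have h := (tendsto_rpow_neg_atTop (y := (1 / 2 : ℝ)) (by norm_num)).comp
    tendsto_natCast_atTop_atTop
  simpa using (h.div_const a).mul_const b

lemma hasSum_combinedWeight_sq (hα : 0 < α) (hlam : 0 < lam) (hτ : ∀ r, 0 ≤ τ r) (u : ι → ℝ)
    {n : ℕ} (hn : 1 ≤ n) :
    HasSum (fun i => combinedWeight α lam τ u n i ^ 2) ((1 / Real.Gamma α) ^ 2 *
      ∫ y : ℝ, (∑ r, u r * roundedKernel (temperedPower (α - 1) lam) n (τ r) ⌊n * y⌋) ^ 2) := by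
  have hn0 : (0 : ℝ) < n := by exact_mod_cast hn
  have h_rpow : ((n : ℝ) ^ (-(1 / 2) : ℝ)) ^ 2 = (n : ℝ)⁻¹ := by
    rw [← Real.rpow_mul_natCast hn0.le, ← Real.rpow_neg_one]
    norm_num
  have h := (hasSum_of_integrable_comp_floor_mul
    (F := fun m => (∑ r, u r * roundedKernel (temperedPower (α - 1) lam) n (τ r) m) ^ 2) hn0
    (integrable_sq_sum_mul_roundedKernel (isRoundingEnvelope_temperedPower _ hlam.le)
      (integrable_temperedBound (by linarith) hlam) hτ u hn)).mul_left ((1 / Real.Gamma α) ^ 2)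
  rw [← (Equiv.addRight (1 : ℤ)).hasSum_iff]
  refine h.congr_fun fun m => ?_
  simp only [Function.comp_apply, Equiv.coe_addRight, combinedWeight_add_one α lam hτ u hn,
    mul_pow, div_pow, h_rpow]
  ring

lemma kernel_half_add (α lam t : ℝ) :
    kernel (1 / 2 + α) lam t = integratedKernel (temperedPower (α - 1) lam) t := by
  unfold kernel integratedKernel
  ring_nf

lemma tendsto_tsum_combinedWeight_sq (hα : 0 < α) (hlam : 0 < lam) (hτ : ∀ r, 0 ≤ τ r)
    (u : ι → ℝ) :
    Tendsto (fun n => ∑' i, combinedWeight α lam τ u n i ^ 2) atTop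
      (𝓝 (∫ y, (∑ r, u r * kernel (1 / 2 + α) lam (τ r) y) ^ 2
        ∂(ENNReal.ofReal ((1 / Real.Gamma α) ^ 2) • volume))) := by
  rw [integral_smul_measure, ENNReal.toReal_ofReal (by positivity), smul_eq_mul]
  simp only [kernel_half_add]
  have h_cont : ∀ᵐ x, ContinuousAt (temperedPower (α - 1) lam) x := by
    filter_upwards [volume.ae_ne 0] with x hx using continuousAt_temperedPower _ _ hx
  refine ((tendsto_integral_sq_sum_mul_roundedKernel
    (isRoundingEnvelope_temperedPower (α - 1) hlam.le)
    (integrable_temperedBound (by linarith) hlam) h_cont hτ u).const_mul _).congr' ?_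
  filter_upwards [eventually_ge_atTop 1] with n hn
  exact (hasSum_combinedWeight_sq hα hlam hτ u hn).tsum_eq.symm

variable {Ω Ω' : Type*} [MeasurableSpace Ω] [MeasurableSpace Ω'] {P : Measure Ω}
  {P' : Measure Ω'} {μ : Measure ℝ} {ζ : ℤ → Ω → ℝ}

lemma ae_hasSum_combinedWeight_mul (hζ : ∀ i, HasLaw (ζ i) μ P) (hμ : Integrable (fun x => x) μ)
    (hlam : 0 < lam) (τ u : ι → ℝ) {n : ℕ} (hn : 1 ≤ n) :
    ∀ᵐ ω ∂P, HasSum (fun i => combinedWeight α lam τ u n i * ζ i ω)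
      (∑ r, u r * ((n : ℝ) ^ (-(1 / 2 + α)) * partialSum α (lam / n) ζ (n * τ r) ω)) := by
  filter_upwards [ae_hasSum_partialSum (α := α) hζ hμ (κ := lam / n) (by positivity)] with ω hω
  have h := hasSum_sum fun (r : ι) (_ : r ∈ Finset.univ) =>
    ((hω (n * τ r)).mul_left ((n : ℝ) ^ (-(1 / 2 + α)))).mul_left (u r)
  refine h.congr_fun fun i => ?_
  simp only [combinedWeight, Finset.sum_mul, mul_assoc]

theorem tendstoInDistribution_sum_mul_partialSum [IsProbabilityMeasure P] [IsProbabilityMeasure P']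
    (hα : 0 < α) (hlam : 0 < lam) (hindep : iIndepFun ζ P) (hζ : ∀ i, HasLaw (ζ i) μ P)
    (hμ : Integrable (fun x => x) μ) (h0 : ∫ x, x ∂μ = 0) (h1 : ∫ x, x ^ 2 ∂μ = 1)
    (hτ : ∀ r, 0 ≤ τ r) (u : ι → ℝ) {Z : Ω' → ℝ}
    (hZ : HasLaw Z (gaussianReal 0 (∫ y, (∑ r, u r * kernel (1 / 2 + α) lam (τ r) y) ^ 2
      ∂(ENNReal.ofReal ((1 / Real.Gamma α) ^ 2) • volume)).toNNReal) P') :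
    TendstoInDistribution (fun (n : ℕ) ω =>
        ∑ r, u r * ((n : ℝ) ^ (-(1 / 2 + α)) * partialSum α (lam / n) ζ (n * τ r) ω))
      atTop Z (fun _ => P) P' := by
  have h_ge := eventually_ge_atTop 1
  refine tendstoInDistribution_of_hasSum_mul hindep hζ h0 h1
    (tendsto_rpow_neg_half_div_mul (Real.Gamma α) _)
    (h_ge.mono fun n hn => abs_combinedWeight_le hα hlam hτ u hn)
    (h_ge.mono fun n hn => (hasSum_combinedWeight_sq hα hlam hτ u hn).summable) ?_
    (fun n => Finset.aemeasurable_fun_sum _ fun r _ =>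
      (aemeasurable_rpow_mul_partialSum hζ hμ hlam _ (τ r) n).const_mul (u r))
    (h_ge.mono fun n hn => ae_hasSum_combinedWeight_mul hζ hμ hlam τ u hn) hZ
  rw [Real.coe_toNNReal _ (integral_nonneg fun y => sq_nonneg _)]
  exact tendsto_tsum_combinedWeight_sq hα hlam hτ u

end LinearCombination

end TemperedHermite

theorem theorem5p2
    {Ω : Type*} [MeasurableSpace Ω] (P : Measure Ω) [IsProbabilityMeasure P]
    {Ω' : Type*} [MeasurableSpace Ω'] (P' : Measure Ω') [IsProbabilityMeasure P']
    (α H lam : ℝ) (hα : 0 < α) (hH : H = 1 / 2 + α) (hlam : 0 < lam)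
    -- i.i.d. innovations with mean zero and variance one
    (ζ : ℤ → Ω → ℝ) (hindep : iIndepFun ζ P) (hident : ∀ i j, IdentDistrib (ζ i) (ζ j) P P)
    (hL2 : ∀ j, MemLp (ζ j) 2 P) (hmean : ∀ j, ∫ ω, ζ j ω ∂P = 0)
    (hvar : ∀ j, variance (ζ j) P = 1)
    -- the tempered Hermite process of order one, with control measure `Γ(α)⁻² dx`
    (B : Set ℝ → Ω' → ℝ) (Z : ℝ → Ω' → ℝ)
    (hZ : TemperedHermite.IsTHP P' (1 / Real.Gamma α) H lam B Z)
    (p : ℕ) (t : Fin p → ℝ) (ht : ∀ r, 0 ≤ t r) :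
    TendstoInDistribution
      (fun (n : ℕ) (ω : Ω) (r : Fin p) =>
        (n : ℝ) ^ (-H) * TemperedHermite.partialSum α (lam / n) ζ (n * t r) ω)
      atTop (fun (ω : Ω') (r : Fin p) => Z (t r) ω) (fun _ => P) P' := by
  subst hH
  have hm (i : ℤ) : AEMeasurable (ζ i) P := (hL2 i).aestronglyMeasurable.aemeasurable
  have hζ (i : ℤ) : HasLaw (ζ i) (P.map (ζ 0)) P := ⟨hm i, (hident i 0).map_eq⟩
  have h_int : Integrable (fun x => x) (P.map (ζ 0)) :=
    (integrable_map_measure (by fun_prop) (hm 0)).2 ((hL2 0).integrable one_le_two)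
  have h_mean : ∫ x, x ∂P.map (ζ 0) = 0 := (hζ 0).integral_eq.symm.trans (hmean 0)
  have h_sq : ∫ x, x ^ 2 ∂P.map (ζ 0) = 1 := by
    rw [← hvar 0, variance_of_integral_eq_zero (hm 0) (hmean 0)]
    exact ((hζ 0).integral_comp (f := fun x => x ^ 2) (by fun_prop)).symm
  have hZ_int (r : Fin p) := hZ.integral (t r) (ht r)
  refine TemperedHermite.tendstoInDistribution_pi_of_forall_sum
    (fun n => aemeasurable_pi_lambda _ fun r =>
      TemperedHermite.aemeasurable_rpow_mul_partialSum hζ h_int hlam _ (t r) n)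
    (aemeasurable_pi_lambda _ fun r => (hZ_int r).2.1.aestronglyMeasurable.aemeasurable) fun u => ?_
  refine TemperedHermite.tendstoInDistribution_sum_mul_partialSum hα hlam hindep hζ h_int h_mean
    h_sq ht u ?_
  have h_law := (TemperedHermite.IsStochasticIntegral.sum_smul hZ.randomMeasure Finset.univ u
    hZ_int).hasLaw hZ.randomMeasure
  simpa [Finset.sum_fn] using h_law
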